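/- Let $E$ be an AL-space, i.e. a real Banach lattice with $\|f+g\|=\|f\|+\|g\|$ for all $0\le f,g\in E$. Let $J=\{1,2,3,\dots\}$ or $J=(0,\infty)$, and let $\mathscr T=(T_t)_{t\in J}$ be a family of bounded linear operators on $E$ with $T_{t+s}=T_tT_s$ for all $s,t\in J$ (no continuity in $t$ is assumed), with $\sup_{t\in J}\|T_t\|<\infty$, and with $T_tf\ge 0$ for all $0\le f\in E$ and $t\in J$. Assume that every $T_t$ is a lattice homomorphism. Here $f>0$ means $f\ge 0$ and $f\ne 0$, and $f^-=(-f)\vee 0$. Then the following assertions are equivalent: (i) There is a bounded linear operator $P$ on $E$ with $Pf>0$ for every $f>0$ such that $T_tf\to Pf$ in norm as $t\to\infty$ for every $f\in E$. (ii) $T_t=\mathrm{id}_E$ for all $t\in J$. (iii) For every $f>0$ in $E$ there is a non-zero $h_f\in E$ with $h_f\ge 0$ and $\lim_{t\to\infty}\|(T_tf-h_f)^-\|=0$. -/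

import Mathlib

open Filter Topology

/-- An AL-space: a real Banach lattice whose norm is additive on the positive cone. The order is a
vector lattice order (`IsOrderedAddMonoid`, `IsOrderedModule`), the norm is a lattice norm
(`HasSolidNorm`) and the space is complete. -/
class ALSpace (E : Type*) [NormedAddCommGroup E] [NormedSpace ℝ E] [Lattice E]
    [IsOrderedAddMonoid E] [IsOrderedModule ℝ E] [HasSolidNorm E] [CompleteSpace E] : Prop where
  norm_add_of_nonneg : ∀ f g : E, 0 ≤ f → 0 ≤ g → ‖f + g‖ = ‖f‖ + ‖g‖

/-- The discrete time set `{1, 2, 3, …}`, as a set of real numbers. -/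
def discreteTimes : Set ℝ := {t | ∃ n : ℕ, 1 ≤ n ∧ t = n}

/-- The continuous time set `(0, ∞)`. -/
def continuousTimes : Set ℝ := Set.Ioi 0

section Semigroups

variable {E : Type*} [NormedAddCommGroup E] [NormedSpace ℝ E]

/-- The semigroup law `T_{s+t} = T_s T_t` for a family `(T_t)_{t ∈ J}` of bounded operators. No
continuity in `t` is required. -/
def IsOperatorSemigroup {J : Set ℝ} (T : J → E →L[ℝ] E) : Prop :=
  ∀ s t u : J, (u : ℝ) = (s : ℝ) + (t : ℝ) → T u = (T s).comp (T t)

/-- `sup_{t ∈ J} ‖T_t‖ < ∞`. -/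
def IsBoundedFamily {J : Set ℝ} (T : J → E →L[ℝ] E) : Prop :=
  ∃ C : ℝ, ∀ t : J, ‖T t‖ ≤ C

/-- `T_t f → P f` in norm as `t → ∞` in `J`, for every `f`. -/
def ConvergesStrongly {J : Set ℝ} (T : J → E →L[ℝ] E) (P : E →L[ℝ] E) : Prop :=
  ∀ f : E, Tendsto (fun t : J => T t f) atTop (𝓝 (P f))

variable [Lattice E]

/-- A positive operator maps the positive cone into itself. -/
def IsPositiveOperator (S : E →L[ℝ] E) : Prop :=
  ∀ f : E, 0 ≤ f → 0 ≤ S f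

/-- A lattice homomorphism: a (linear) operator preserving binary suprema and infima. -/
def IsLatticeHomomorphism (S : E →L[ℝ] E) : Prop :=
  ∀ f g : E, S (f ⊔ g) = S f ⊔ S g ∧ S (f ⊓ g) = S f ⊓ S g

/-- `h` is an individual lower bound for `((T_t), f)`: `h` lies in the positive cone and
`‖(T_t f - h)⁻‖ → 0` as `t → ∞` in `J`. -/
def IsIndividualLowerBound {J : Set ℝ} (T : J → E →L[ℝ] E) (f h : E) : Prop :=
  0 ≤ h ∧ Tendsto (fun t : J => ‖(T t f - h)⁻‖) atTop (𝓝 0)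

end Semigroups

/-! From (i): `P T_s = P` and `P|g| = |P g|`, so `P` kills `|T_s f - f|`, and strict positivity
forces `T_s f = f`. From (iii): norm additivity gives the orbit of `f > 0` a greatest lower bound
vector `h`. Lattice homomorphisms carry lower bounds to lower bounds, so `T_t h ≤ h`, and `T_t h`
decreases to a fixed `k`, non-zero by (iii) applied to `h`. As `T_t (f - k)⁻ = (T_t f - k)⁻ → 0`,
(iii) excludes `(f - k)⁻ > 0`, hence `k ≤ f`. So every `f > 0` dominates a non-zero positive fixed
vector, and an exhaustion argument makes `f` itself fixed. -/

theorem norm_le_norm_of_nonneg_of_le {E : Type*} [NormedAddCommGroup E] [Lattice E]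
    [IsOrderedAddMonoid E] [HasSolidNorm E] {f g : E} (hf : 0 ≤ f) (hfg : f ≤ g) : ‖f‖ ≤ ‖g‖ := by
  apply norm_le_norm_of_abs_le_abs
  rwa [abs_of_nonneg hf, abs_of_nonneg (hf.trans hfg)]

theorem negPart_sub_sup_le {G : Type*} [AddCommGroup G] [Lattice G] [IsOrderedAddMonoid G]
    (a h k : G) :
    (a - h ⊔ k)⁻ ≤ (a - h)⁻ + (a - k)⁻ := by
  have h1 : h - a ≤ (a - h)⁻ := by rw [← neg_sub]; exact neg_le_negPart _
  have h2 : k - a ≤ (a - k)⁻ := by rw [← neg_sub]; exact neg_le_negPart _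
  rw [negPart_def (a - h ⊔ k), neg_sub, sup_sub]
  exact sup_le (sup_le (h1.trans (le_add_of_nonneg_right (negPart_nonneg _)))
    (h2.trans (le_add_of_nonneg_left (negPart_nonneg _))))
    (add_nonneg (negPart_nonneg _) (negPart_nonneg _))

theorem negPart_sub_le_add_abs {G : Type*} [AddCommGroup G] [Lattice G] [IsOrderedAddMonoid G]
    (a h k : G) :
    (a - h)⁻ ≤ (a - k)⁻ + |h - k| := by
  have h1 : k - a ≤ (a - k)⁻ := by rw [← neg_sub]; exact neg_le_negPart _
  rw [negPart_def (a - h), neg_sub]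
  refine sup_le ?_ (add_nonneg (negPart_nonneg _) (abs_nonneg _))
  calc h - a = (k - a) + (h - k) := by abel
    _ ≤ _ := add_le_add h1 (le_abs_self _)

/-! ### Monotone convergence and greatest elements in AL-spaces -/

section ALSpace

variable {E : Type*} [NormedAddCommGroup E] [NormedSpace ℝ E] [Lattice E]
    [IsOrderedAddMonoid E] [IsOrderedModule ℝ E] [HasSolidNorm E] [CompleteSpace E]

theorem ALSpace.norm_sub_of_le [ALSpace E] {f g : E} (hf : 0 ≤ f) (hfg : f ≤ g) :
    ‖g - f‖ = ‖g‖ - ‖f‖ := by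
  have h := ALSpace.norm_add_of_nonneg f (g - f) hf (sub_nonneg.2 hfg)
  rw [add_sub_cancel] at h
  linarith

/-- In an AL-space a norm bounded increasing sequence of positive elements converges in norm. -/
theorem ALSpace.exists_tendsto_of_monotone [ALSpace E] {u : ℕ → E} (hu : Monotone u)
    (h0 : ∀ n, 0 ≤ u n) {M : ℝ} (hM : ∀ n, ‖u n‖ ≤ M) : ∃ f, Tendsto u atTop (𝓝 f) := by
  have hmono : Monotone fun n => ‖u n‖ := fun m n hmn =>
    norm_le_norm_of_nonneg_of_le (h0 m) (hu hmn)
  have hconv := tendsto_atTop_ciSup hmono ⟨M, by rintro _ ⟨n, rfl⟩; exact hM n⟩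
  apply cauchySeq_tendsto_of_complete
  rw [Metric.cauchySeq_iff']
  intro ε hε
  obtain ⟨N, hN⟩ := Metric.cauchySeq_iff'.1 hconv.cauchySeq ε hε
  refine ⟨N, fun n hn => ?_⟩
  rw [dist_eq_norm, ALSpace.norm_sub_of_le (h0 N) (hu hn)]
  exact (le_abs_self _).trans_lt (hN n hn)

/-- In an AL-space a decreasing sequence of positive elements converges in norm. -/
theorem ALSpace.exists_tendsto_of_antitone [ALSpace E] {u : ℕ → E} (hu : Antitone u)
    (h0 : ∀ n, 0 ≤ u n) : ∃ f, Tendsto u atTop (𝓝 f) := by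
  have hle : ∀ n, u n ≤ u 0 := fun n => hu (Nat.zero_le n)
  obtain ⟨g, hg⟩ := ALSpace.exists_tendsto_of_monotone (u := fun n => u 0 - u n)
    (fun m n hmn => sub_le_sub_left (hu hmn) _) (fun n => sub_nonneg.2 (hle n)) (M := ‖u 0‖)
    (fun n => norm_le_norm_of_nonneg_of_le (sub_nonneg.2 (hle n)) (sub_le_self _ (h0 n)))
  exact ⟨u 0 - g, by simpa using hg.const_sub (u 0)⟩

/-- In an AL-space a nonempty, closed, norm bounded set of positive elements that is stable under
suprema has a greatest element. -/
theorem ALSpace.exists_isGreatest [ALSpace E] {S : Set E} (hne : S.Nonempty) (hcl : IsClosed S)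
    (h0 : ∀ f ∈ S, 0 ≤ f) (hsup : SupClosed S) {M : ℝ} (hM : ∀ f ∈ S, ‖f‖ ≤ M) :
    ∃ h, IsGreatest S h := by
  have hbdd : BddAbove (norm '' S) := ⟨M, by rintro _ ⟨f, hf, rfl⟩; exact hM f hf⟩
  obtain ⟨r, -, hr, hrS⟩ := exists_seq_tendsto_sSup (hne.image norm) hbdd
  choose v hvS hv using hrS
  have hpS : ∀ n, partialSups v n ∈ S := fun n => by
    induction n with
    | zero => simpa using hvS 0
    | succ n ih => rw [partialSups_add_one]; exact hsup ih (hvS (n + 1))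
  obtain ⟨h, hh⟩ := ALSpace.exists_tendsto_of_monotone (partialSups v).monotone
    (fun n => h0 _ (hpS n)) (fun n => hM _ (hpS n))
  have hhS : h ∈ S := hcl.mem_of_tendsto hh (Eventually.of_forall hpS)
  have hnorm : sSup (norm '' S) ≤ ‖h‖ := by
    refine le_of_tendsto_of_tendsto' hr hh.norm fun n => ?_
    rw [← hv n]
    exact norm_le_norm_of_nonneg_of_le (h0 _ (hvS n)) (le_partialSups v n)
  refine ⟨h, hhS, fun k hk => ?_⟩
  -- `h` has maximal norm in `S`, so passing to `h ⊔ k` gains no norm; additivity then gives `h ⊔ k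
  -- = h`.
  have hle : ‖h ⊔ k‖ ≤ ‖h‖ := (le_csSup hbdd ⟨_, hsup hhS hk, rfl⟩).trans hnorm
  have hsub := ALSpace.norm_sub_of_le (h0 h hhS) (le_sup_left : h ≤ h ⊔ k)
  have hz : h ⊔ k - h = 0 := norm_le_zero_iff.1 (by linarith)
  rw [← sub_eq_zero.1 hz]
  exact le_sup_right

end ALSpace

section LatticeHomomorphism

variable {E : Type*} [NormedAddCommGroup E] [NormedSpace ℝ E] [Lattice E]

theorem IsLatticeHomomorphism.map_negPart {S : E →L[ℝ] E} (hS : IsLatticeHomomorphism S) (f : E) :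
    S f⁻ = (S f)⁻ := by
  rw [negPart_def, negPart_def, (hS _ _).1, map_neg, map_zero]

theorem IsPositiveOperator.monotone [IsOrderedAddMonoid E] {S : E →L[ℝ] E}
    (hS : IsPositiveOperator S) : Monotone S := fun f g hfg => by
  have := hS _ (sub_nonneg.2 hfg)
  rwa [map_sub, sub_nonneg] at this

theorem eq_id_of_forall_nonneg [IsOrderedAddMonoid E] {S : E →L[ℝ] E}
    (h : ∀ f, 0 ≤ f → S f = f) : S = ContinuousLinearMap.id ℝ E := by
  ext f
  rw [← posPart_sub_negPart f, map_sub, h _ (posPart_nonneg f), h _ (negPart_nonneg f)]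
  rfl

end LatticeHomomorphism

/-! ### Arithmetic of the time set -/

section Times

variable {J : Set ℝ}

theorem one_mem_times (hJ : J = discreteTimes ∨ J = continuousTimes) : (1 : ℝ) ∈ J := by
  rcases hJ with rfl | rfl
  · exact ⟨1, le_rfl, by simp⟩
  · exact Set.mem_Ioi.2 one_pos

theorem times_pos (hJ : J = discreteTimes ∨ J = continuousTimes) {s : ℝ} (hs : s ∈ J) :
    0 < s := by
  rcases hJ with rfl | rfl
  · obtain ⟨n, hn, rfl⟩ := hs
    exact_mod_cast hn
  · exact hs

theorem add_mem_times (hJ : J = discreteTimes ∨ J = continuousTimes) {s t : ℝ} (hs : s ∈ J)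
    (ht : t ∈ J) : s + t ∈ J := by
  rcases hJ with rfl | rfl
  · obtain ⟨n, hn, rfl⟩ := hs
    obtain ⟨m, hm, rfl⟩ := ht
    exact ⟨n + m, by omega, by push_cast; rfl⟩
  · exact add_pos (Set.mem_Ioi.1 hs) (Set.mem_Ioi.1 ht)

theorem sub_mem_times (hJ : J = discreteTimes ∨ J = continuousTimes) {s t : ℝ} (hs : s ∈ J)
    (ht : t ∈ J) (hst : s < t) : t - s ∈ J := by
  rcases hJ with rfl | rfl
  · obtain ⟨n, hn, rfl⟩ := hs
    obtain ⟨m, hm, rfl⟩ := ht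
    have hnm : n < m := by exact_mod_cast hst
    exact ⟨m - n, by omega, by push_cast [hnm.le]; rfl⟩
  · exact sub_pos.2 hst

theorem natCast_succ_mem_times (hJ : J = discreteTimes ∨ J = continuousTimes) (n : ℕ) :
    ((n + 1 : ℕ) : ℝ) ∈ J := by
  rcases hJ with rfl | rfl
  · exact ⟨n + 1, by omega, rfl⟩
  · exact Set.mem_Ioi.2 (by positivity)

/-- Limits survive a time shift by `s`. Values of `G` at times `≤ s` are unconstrained, since `u -
s` then leaves `J`. -/
theorem tendsto_sub_times (hJ : J = discreteTimes ∨ J = continuousTimes) {X : Type*} {l : Filter X}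
    {F : J → X} (hF : Tendsto F atTop l) (s : J) {G : J → X}
    (hG : ∀ t u : J, (u : ℝ) = s + t → G u = F t) : Tendsto G atTop l := by
  have : Nonempty J := ⟨s⟩
  intro U hU
  obtain ⟨N, hN⟩ := mem_atTop_sets.1 (hF hU)
  refine mem_atTop_sets.2 ⟨⟨s + N, add_mem_times hJ s.2 N.2⟩, fun u hu => ?_⟩
  have hu' : (s : ℝ) + N ≤ u := hu
  have hlt : (s : ℝ) < u := by linarith [times_pos hJ N.2]
  have hNt : N ≤ (⟨u - s, sub_mem_times hJ s.2 u.2 hlt⟩ : J) :=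
    Subtype.coe_le_coe.1 (by simpa using le_sub_iff_add_le'.2 hu')
  have := hN _ hNt
  rw [Set.mem_preimage] at this ⊢
  rwa [hG ⟨u - s, sub_mem_times hJ s.2 u.2 hlt⟩ u (by simp)]

end Times

/-! ### Lower bounds of an orbit -/

section LowerBounds

variable {E : Type*} [NormedAddCommGroup E] [NormedSpace ℝ E] [Lattice E]
    {J : Set ℝ} {T : J → E →L[ℝ] E}

/-- Rests on `(T_{s+t} f - T_s h)⁻ = T_s (T_t f - h)⁻` and continuity of `T_s`. -/
theorem IsIndividualLowerBound.apply (hJ : J = discreteTimes ∨ J = continuousTimes)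
    (hT : IsOperatorSemigroup T) (hpos : ∀ t, IsPositiveOperator (T t))
    (hlat : ∀ t, IsLatticeHomomorphism (T t)) {f h : E} (hh : IsIndividualLowerBound T f h)
    (s : J) : IsIndividualLowerBound T f (T s h) := by
  refine ⟨hpos s h hh.1, ?_⟩
  have h0 : Tendsto (fun t : J => (T t f - h)⁻) atTop (𝓝 0) :=
    tendsto_zero_iff_norm_tendsto_zero.2 hh.2
  have h1 := ((T s).continuous.tendsto 0).comp h0
  rw [map_zero] at h1
  refine tendsto_sub_times hJ (tendsto_zero_iff_norm_tendsto_zero.1 h1) s fun t u hu => ?_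
  simp only [Function.comp]
  rw [(hlat s).map_negPart, map_sub, hT s t u hu]
  rfl

variable [IsOrderedAddMonoid E] [HasSolidNorm E]

theorem IsIndividualLowerBound.mono_right {f h k : E} (hh : IsIndividualLowerBound T f h)
    (hk : 0 ≤ k) (hkh : k ≤ h) : IsIndividualLowerBound T f k := by
  refine ⟨hk, squeeze_zero (fun _ => norm_nonneg _) (fun t => ?_) hh.2⟩
  exact norm_le_norm_of_nonneg_of_le (negPart_nonneg _) (negPart_anti (sub_le_sub_left hkh _))

theorem supClosed_isIndividualLowerBound (f : E) :
    SupClosed {h | IsIndividualLowerBound T f h} := by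
  intro h hh k hk
  refine ⟨hh.1.trans le_sup_left, squeeze_zero (fun _ => norm_nonneg _) (fun t => ?_)
    (by simpa using hh.2.add hk.2)⟩
  exact (norm_le_norm_of_nonneg_of_le (negPart_nonneg _) (negPart_sub_sup_le _ h k)).trans
    (norm_add_le _ _)

theorem isClosed_isIndividualLowerBound (f : E) :
    IsClosed {h | IsIndividualLowerBound T f h} := by
  refine isClosed_of_closure_subset fun h hh => ?_
  refine ⟨isClosed_Ici.closure_subset_iff.2 (fun k hk => hk.1) hh, ?_⟩
  rw [Metric.tendsto_nhds]
  intro ε hε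
  obtain ⟨k, hk, hkh⟩ := Metric.mem_closure_iff.1 hh (ε / 2) (half_pos hε)
  filter_upwards [Metric.tendsto_nhds.1 hk.2 (ε / 2) (half_pos hε)] with t ht
  rw [dist_zero_right, norm_norm] at ht ⊢
  rw [dist_eq_norm] at hkh
  calc ‖(T t f - h)⁻‖ ≤ ‖(T t f - k)⁻ + |h - k|‖ :=
        norm_le_norm_of_nonneg_of_le (negPart_nonneg _) (negPart_sub_le_add_abs _ h k)
    _ ≤ ‖(T t f - k)⁻‖ + ‖|h - k|‖ := norm_add_le _ _
    _ < ε := by rw [norm_abs_eq_norm]; linarith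

theorem IsIndividualLowerBound.norm_le [Nonempty J] {C : ℝ} (hC : ∀ t, ‖T t‖ ≤ C) {f h : E}
    (hh : IsIndividualLowerBound T f h) : ‖h‖ ≤ C * ‖f‖ := by
  have hlim : Tendsto (fun t : J => C * ‖f‖ + ‖(T t f - h)⁻‖) atTop (𝓝 (C * ‖f‖)) := by
    simpa using hh.2.const_add (C * ‖f‖)
  refine ge_of_tendsto' hlim fun t => ?_
  have hle : h ≤ |T t f| + (T t f - h)⁻ := by
    have := neg_le_negPart (T t f - h)
    rw [neg_sub, sub_le_iff_le_add'] at this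
    exact this.trans (add_le_add_left (le_abs_self _) _)
  calc ‖h‖ ≤ ‖|T t f| + (T t f - h)⁻‖ := norm_le_norm_of_nonneg_of_le hh.1 hle
    _ ≤ ‖|T t f|‖ + ‖(T t f - h)⁻‖ := norm_add_le _ _
    _ ≤ _ := by
      rw [norm_abs_eq_norm]
      gcongr
      exact (T t).le_of_opNorm_le (hC t) f

variable [NeBot (atTop : Filter J)]

/-- A fixed lower bound of the orbit of `f` lies below `f` if no positive orbit is
asymptotically negligible. -/
theorem IsIndividualLowerBound.le_of_fixed (hlat : ∀ t, IsLatticeHomomorphism (T t))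
    (hex : ∀ f : E, 0 < f → ∃ h : E, h ≠ 0 ∧ IsIndividualLowerBound T f h) {f h : E}
    (hh : IsIndividualLowerBound T f h) (hfix : ∀ t, T t h = h) : h ≤ f := by
  by_contra hne
  have hpos : 0 < (f - h)⁻ := by
    refine lt_of_le_of_ne (negPart_nonneg _) fun h0 => hne ?_
    rw [eq_comm, negPart_eq_zero] at h0
    exact sub_nonneg.1 h0
  obtain ⟨k, hk0, hk⟩ := hex _ hpos
  have hTt : ∀ t, T t (f - h)⁻ = (T t f - h)⁻ := fun t => by
    rw [(hlat t).map_negPart, map_sub, hfix t]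
  refine hk0 (norm_le_zero_iff.1 (ge_of_tendsto' (b := ‖k‖) (x := atTop) (a := (0 : ℝ))
    (by simpa using hh.2.add hk.2) fun t => ?_))
  -- Both summands tend to zero in norm, which forces `k = 0`.
  have hle : k ≤ T t (f - h)⁻ + (T t (f - h)⁻ - k)⁻ := by
    have := neg_le_negPart (T t (f - h)⁻ - k)
    rwa [neg_sub, sub_le_iff_le_add'] at this
  rw [hTt] at hle
  rw [hTt]
  exact (norm_le_norm_of_nonneg_of_le hk.1 hle).trans (norm_add_le _ _)

end LowerBounds

/-! ### Fixed vectors and the two main implications -/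

section FixedPoints

variable {E : Type*} [NormedAddCommGroup E] [NormedSpace ℝ E] [Lattice E]
    [IsOrderedAddMonoid E] [IsOrderedModule ℝ E] [HasSolidNorm E] [CompleteSpace E] [ALSpace E]
    {J : Set ℝ} {T : J → E →L[ℝ] E}

/-- If `h` is positive and super-fixed, then `T_t h` decreases to a fixed point which dominates
every lower bound of the orbit of `h`. -/
theorem exists_fixed_of_superfixed (hJ : J = discreteTimes ∨ J = continuousTimes)
    (hT : IsOperatorSemigroup T) (hpos : ∀ t, IsPositiveOperator (T t)) {h : E} (h0 : 0 ≤ h)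
    (hsuper : ∀ t, T t h ≤ h) :
    ∃ k, 0 ≤ k ∧ k ≤ h ∧ (∀ t, T t k = k) ∧ ∀ g, IsIndividualLowerBound T h g → g ≤ k := by
  have : Nonempty J := ⟨⟨1, one_mem_times hJ⟩⟩
  have hanti : ∀ s t : J, s ≤ t → T t h ≤ T s h := fun s t hst => by
    rcases hst.eq_or_lt with rfl | hlt
    · exact le_rfl
    · have hlt' : (s : ℝ) < t := hlt
      rw [hT s ⟨t - s, sub_mem_times hJ s.2 t.2 hlt'⟩ t (by simp)]
      exact (hpos s).monotone (hsuper _)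
  -- A cofinal sequence in `J`; it starts at 1 because `0 ∉ J`.
  let ν : ℕ → J := fun n => ⟨((n + 1 : ℕ) : ℝ), natCast_succ_mem_times hJ n⟩
  have hν : ∀ t : J, ∃ n, t ≤ ν n := fun t => by
    obtain ⟨n, hn⟩ := exists_nat_ge (t : ℝ)
    exact ⟨n, Subtype.coe_le_coe.1 (hn.trans (by simp [ν]))⟩
  have hνmono : Monotone ν := fun m n hmn => Subtype.coe_le_coe.1 (by simpa [ν] using hmn)
  have huanti : Antitone fun n => T (ν n) h := fun m n hmn => hanti _ _ (hνmono hmn)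
  obtain ⟨k, hk⟩ := ALSpace.exists_tendsto_of_antitone huanti fun n => hpos _ _ h0
  have hkle : ∀ t, k ≤ T t h := fun t => by
    obtain ⟨n, hn⟩ := hν t
    exact (huanti.le_of_tendsto hk n).trans (hanti _ _ hn)
  have hlek : ∀ g, (∀ t, g ≤ T t h) → g ≤ k := fun g hg => ge_of_tendsto' hk fun n => hg _
  refine ⟨k, hlek 0 fun t => hpos _ _ h0, (hkle (ν 0)).trans (hsuper _), fun s => ?_,
    fun g hg => hlek g fun s => ?_⟩
  · have hs := ((T s).continuous.tendsto k).comp hk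
    refine le_antisymm (hlek _ fun t => ?_) (ge_of_tendsto' hs fun n => ?_)
    · refine ((hpos s).monotone (hkle t)).trans ?_
      have hadd : (s : ℝ) + t ∈ J := add_mem_times hJ s.2 t.2
      have hst : T ⟨s + t, hadd⟩ h = T s (T t h) := by rw [hT s t ⟨s + t, hadd⟩ rfl]; rfl
      rw [← hst]
      exact hanti _ _ (Subtype.coe_le_coe.1 (by simpa using (times_pos hJ s.2).le))
    · have hadd : (s : ℝ) + ν n ∈ J := add_mem_times hJ s.2 (ν n).2
      have hst : T ⟨s + ν n, hadd⟩ h = T s (T (ν n) h) := by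
        rw [hT s (ν n) ⟨s + ν n, hadd⟩ rfl]; rfl
      simp only [Function.comp]
      rw [← hst]
      exact hkle _
  · have hle : ‖(T s h - g)⁻‖ ≤ 0 := by
      refine ge_of_tendsto hg.2 ?_
      filter_upwards [eventually_ge_atTop s] with t ht
      exact norm_le_norm_of_nonneg_of_le (negPart_nonneg _)
        (negPart_anti (sub_le_sub_right (hanti _ _ ht) _))
    exact sub_nonneg.1 (negPart_eq_zero.1 (norm_le_zero_iff.1 hle))

/-- If all positive orbits have non-zero lower bounds, there is a non-zero positive fixed point
below every non-zero positive element. -/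
theorem exists_fixed_le (hJ : J = discreteTimes ∨ J = continuousTimes)
    (hT : IsOperatorSemigroup T) (hbdd : IsBoundedFamily T)
    (hpos : ∀ t, IsPositiveOperator (T t)) (hlat : ∀ t, IsLatticeHomomorphism (T t))
    (hex : ∀ f : E, 0 < f → ∃ h : E, h ≠ 0 ∧ IsIndividualLowerBound T f h) {f : E}
    (hf : 0 < f) : ∃ k, 0 < k ∧ k ≤ f ∧ ∀ t, T t k = k := by
  have : Nonempty J := ⟨⟨1, one_mem_times hJ⟩⟩
  obtain ⟨C, hC⟩ := hbdd
  obtain ⟨h₀, hh₀, hlb₀⟩ := hex f hf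
  obtain ⟨h, hh, hmax⟩ := ALSpace.exists_isGreatest (S := {h | IsIndividualLowerBound T f h})
    ⟨h₀, hlb₀⟩ (isClosed_isIndividualLowerBound f) (fun g hg => hg.1)
    (supClosed_isIndividualLowerBound f) (fun g hg => IsIndividualLowerBound.norm_le hC hg)
  have hh0 : 0 < h := (lt_of_le_of_ne hlb₀.1 hh₀.symm).trans_le (hmax hlb₀)
  obtain ⟨k, hk0, hkh, hkfix, hkmax⟩ := exists_fixed_of_superfixed hJ hT hpos hh0.le
    fun t => hmax (IsIndividualLowerBound.apply hJ hT hpos hlat hh t)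
  obtain ⟨g, hg0, hg⟩ := hex h hh0
  exact ⟨k, (lt_of_le_of_ne hg.1 hg0.symm).trans_le (hkmax g hg),
    (hh.mono_right hk0 hkh).le_of_fixed hlat hex hkfix, hkfix⟩

/-- Exhaustion: if the greatest fixed `h` in `[0, f]` were not `f`, a fixed `k > 0` below `f - h`
would make `h + k` a larger one. -/
theorem eq_id_of_lowerBounds (hJ : J = discreteTimes ∨ J = continuousTimes)
    (hT : IsOperatorSemigroup T) (hbdd : IsBoundedFamily T)
    (hpos : ∀ t, IsPositiveOperator (T t)) (hlat : ∀ t, IsLatticeHomomorphism (T t))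
    (hex : ∀ f : E, 0 < f → ∃ h : E, h ≠ 0 ∧ IsIndividualLowerBound T f h) (s : J) :
    T s = ContinuousLinearMap.id ℝ E := by
  refine eq_id_of_forall_nonneg fun f hf => ?_
  obtain ⟨h, ⟨⟨hh0, hhf⟩, hfix⟩, hmax⟩ := ALSpace.exists_isGreatest
    (S := Set.Icc 0 f ∩ {h | ∀ t, T t h = h}) ⟨0, ⟨le_rfl, hf⟩, fun t => map_zero _⟩
    (isClosed_Icc.inter (by
      rw [Set.ofPred_forall]
      exact isClosed_iInter fun t => isClosed_eq (T t).continuous continuous_id))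
    (fun g hg => hg.1.1)
    (fun g hg k hk => ⟨⟨hg.1.1.trans le_sup_left, sup_le hg.1.2 hk.1.2⟩, fun t => by
      rw [(hlat t g k).1, hg.2 t, hk.2 t]⟩)
    (fun g hg => norm_le_norm_of_nonneg_of_le hg.1.1 hg.1.2)
  suffices h = f from this ▸ hfix s
  by_contra hne
  obtain ⟨k, hk0, hkle, hkfix⟩ := exists_fixed_le hJ hT hbdd hpos hlat hex
    (sub_pos.2 (lt_of_le_of_ne hhf hne))
  have hmem : h + k ≤ h := hmax ⟨⟨add_nonneg hh0 hk0.le, le_sub_iff_add_le'.1 hkle⟩, fun t => by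
    rw [map_add, hfix t, hkfix t]⟩
  exact hk0.not_ge (by simpa using hmem)

theorem eq_id_of_convergesStrongly (hJ : J = discreteTimes ∨ J = continuousTimes)
    (hT : IsOperatorSemigroup T) (hlat : ∀ t, IsLatticeHomomorphism (T t)) {P : E →L[ℝ] E}
    (hP : ConvergesStrongly T P) (hPpos : ∀ f : E, 0 < f → 0 < P f) (s : J) :
    T s = ContinuousLinearMap.id ℝ E := by
  have : Nonempty J := ⟨⟨1, one_mem_times hJ⟩⟩
  ext f
  by_contra hne
  have hpos : 0 < |T s f - f| := lt_of_le_of_ne (abs_nonneg _)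
    fun h0 => hne (sub_eq_zero.1 (by
      rw [← norm_eq_zero, ← norm_abs_eq_norm]
      exact norm_eq_zero.2 h0.symm))
  have hshift : P (T s f) = P f := by
    refine tendsto_nhds_unique ?_ (hP f)
    refine tendsto_sub_times hJ (hP (T s f)) s fun t u hu => ?_
    rw [hT t s u (hu.trans (add_comm _ _))]
    rfl
  have habs : ∀ g, P |g| = |P g| := fun g => by
    have hlim : Tendsto (fun t : J => |T t g|) atTop (𝓝 |P g|) := by
      have := (hP g).sup_nhds (hP g).neg
      exact this
    refine tendsto_nhds_unique (hP |g|) (hlim.congr fun t => ?_)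
    rw [abs, abs, (hlat t _ _).1, map_neg]
  have := hPpos _ hpos
  rw [habs, map_sub, hshift, sub_self, abs_zero] at this
  exact lt_irrefl _ this

end FixedPoints

theorem theorem5p5 {E : Type*} [NormedAddCommGroup E] [NormedSpace ℝ E] [Lattice E]
    [IsOrderedAddMonoid E] [IsOrderedModule ℝ E] [HasSolidNorm E] [CompleteSpace E] [ALSpace E]
    (J : Set ℝ) (hJ : J = discreteTimes ∨ J = continuousTimes)
    (T : J → E →L[ℝ] E) (hsemigroup : IsOperatorSemigroup T) (hbounded : IsBoundedFamily T)
    (hpositive : ∀ t, IsPositiveOperator (T t))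
    (hlattice : ∀ t, IsLatticeHomomorphism (T t)) :
    List.TFAE [
      (∃ P : E →L[ℝ] E, ConvergesStrongly T P ∧ ∀ f : E, 0 < f → 0 < P f),
      (∀ t, T t = ContinuousLinearMap.id ℝ E),
      (∀ f : E, 0 < f → ∃ h : E, h ≠ 0 ∧ IsIndividualLowerBound T f h)] := by
  tfae_have 1 → 2 := fun ⟨P, hP, hPpos⟩ =>
    eq_id_of_convergesStrongly hJ hsemigroup hlattice hP hPpos
  tfae_have 2 → 1 := fun hid => ⟨ContinuousLinearMap.id ℝ E,
    fun f => by simpa [hid] using tendsto_const_nhds, fun f hf => hf⟩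
  tfae_have 2 → 3 := fun hid f hf => ⟨f, hf.ne', hf.le, by
    simpa [hid] using tendsto_const_nhds⟩
  tfae_have 3 → 2 := eq_id_of_lowerBounds hJ hsemigroup hbounded hpositive hlattice
  tfae_finish
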